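/- Let $\mathcal A$ be the real algebra of noncommutative Laurent polynomials in the letters $u_n$, $n\in\mathbb Z$ (the group algebra over $\mathbb R$ of the free group on the $u_n$), write $u=u_0$, and let $\mathcal S$ be its shift automorphism, $\mathcal S u_n=u_{n+1}$. Let $\mathcal F=\mathcal A/\big((\mathcal S-1)\mathcal A+[\mathcal A,\mathcal A]\big)$ be the space of local functionals and $\int\mathrm{tr}\colon\mathcal A\to\mathcal F$ the projection. For $F=\int\mathrm{tr}\,f$ the variational derivative $\frac{\delta F}{\delta u}\in\mathcal A$ is determined by $\int\mathrm{tr}\,\big(\frac{\delta F}{\delta u}\,v\big)=\int\mathrm{tr}\,f_*[v]$ for all $v\in\mathcal A$, where $f_*[v]=\frac{d}{d\epsilon}f(u+\epsilon v)\big|_{\epsilon=0}$ is the Fréchet derivative. Write $\mathrm l_a f=af$, $\mathrm r_a f=fa$, $\mathrm c_a=\mathrm r_a-\mathrm l_a$. The formal adjoint $K\mapsto K^\dagger$ of a (possibly nonlocal) difference operator is given by $\mathrm l_a^\dagger=\mathrm r_a$, $\mathrm r_a^\dagger=\mathrm l_a$, $(\mathcal S^{k})^\dagger=\mathcal S^{-k}$,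 linearity, $(KL)^\dagger=L^\dagger K^\dagger$ and $(K^{-1})^\dagger=(K^\dagger)^{-1}$. A formal inverse acts on $\mathcal A$ as the inverse relation; in particular $(\mathcal S-1)^{-1}$ is defined on the image of $\mathcal S-1$, up to the kernel of $\mathcal S-1$. An operator $K$ is Hamiltonian if $K^\dagger=-K$ (as partially defined operators on $\mathcal A$) and the formula $\{F,G\}=\int\mathrm{tr}\,\big(\frac{\delta F}{\delta u}\,K\frac{\delta G}{\delta u}\big)$ gives, for all $F,G\in\mathcal F$, a well-defined value, and is a Lie algebra bracket on $\mathcal F$ (bilinear, alternating, and satisfying the Jacobi identity). **Theorem.** For every integer $p\ge 1$ the nonlocal operator $$H=\mathrm r_u\sum_{i=1}^p\mathcal S^i\,\mathrm r_u-\mathrm l_u\sum_{i=1}^p\mathcal S^{-i}\,\mathrm l_u+\mathrm r_u\mathrm c_u+\mathrm c_u(\mathcal S-1)^{-1}\mathrm c_u$$ is Hamiltonian. With the Hamiltonian functional $h=\int\mathrm{tr}\,u$ it produces the nonabelian Narita–Itoh–Bogoyavlensky lattice: $H\frac{\delta h}{\delta u}$ has exactly one value, so that the evolutionary system $u_t=H\frac{\delta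 h}{\delta u}$ is $$u_t=\sum_{k=1}^p\left(u_k u-u\,u_{-k}\right).$$ -/

import Mathlib

noncomputable section

namespace NIB

/-- The real algebra of nonabelian difference Laurent polynomials in one field variable: Laurent
polynomials in the noncommuting invertible letters `u_n`, `n ∈ ℤ`, i.e. the group algebra of
the free group on the letters. -/
abbrev DiffAlg : Type := MonoidAlgebra ℝ (FreeGroup ℤ)

/-- The generator `u_n`. -/
def u (n : ℤ) : DiffAlg := MonoidAlgebra.of ℝ (FreeGroup ℤ) (FreeGroup.of n)

/-- The inverse `u_n⁻¹` of the generator `u_n`. -/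
def uInv (n : ℤ) : DiffAlg := MonoidAlgebra.of ℝ (FreeGroup ℤ) (FreeGroup.of n)⁻¹

/-- The algebra endomorphism `S ^ k`, with `S ^ k u_n = u_{n + k}`. -/
def shift (k : ℤ) : DiffAlg →ₐ[ℝ] DiffAlg :=
  MonoidAlgebra.mapDomainAlgHom ℝ ℝ (FreeGroup.map fun n : ℤ => n + k)

/-- The subspace `(S - 1) A + [A, A]`. -/
def nullDensities : Submodule ℝ DiffAlg :=
  Submodule.span ℝ {x | ∃ f, x = shift 1 f - f} ⊔
    Submodule.span ℝ {x | ∃ f g : DiffAlg, x = f * g - g * f}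

/-- Local functionals `F = A / ((S - 1) A + [A, A])`. -/
abbrev Functional : Type := DiffAlg ⧸ nullDensities

/-- The projection `f ↦ ∫ tr f`. -/
def intTr : DiffAlg →ₗ[ℝ] Functional := nullDensities.mkQ

theorem u_mul_uInv (n : ℤ) : u n * uInv n = 1 := by
  rw [u, uInv, ← map_mul, mul_inv_cancel, map_one]

theorem uInv_mul_u (n : ℤ) : uInv n * u n = 1 := by
  rw [u, uInv, ← map_mul, inv_mul_cancel, map_one]

/-- The invertible element `u_n + ε S^n v` of `A[ε]`, `ε² = 0`. -/
def perturbedGen (v : DiffAlg) (n : ℤ) : (DualNumber DiffAlg)ˣ where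
  val := TrivSqZeroExt.inl (u n) + TrivSqZeroExt.inr (shift n v)
  inv := TrivSqZeroExt.inl (uInv n) - TrivSqZeroExt.inr (uInv n * shift n v * uInv n)
  val_inv := by
    ext
    · simp [u_mul_uInv]
    · simp [← mul_assoc, u_mul_uInv]
  inv_val := by
    ext
    · simp [uInv_mul_u]
    · simp [mul_assoc, uInv_mul_u]

/-- The substitution `f(u) ↦ f(u + ε v)`, an algebra map `A → A[ε]`, `ε² = 0`. -/
def perturb (v : DiffAlg) : DiffAlg →ₐ[ℝ] DualNumber DiffAlg :=
  MonoidAlgebra.lift ℝ (DualNumber DiffAlg) (FreeGroup ℤ)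
    ((Units.coeHom (DualNumber DiffAlg)).comp (FreeGroup.lift (perturbedGen v)))

/-- The Fréchet derivative `f_*[v]`, the derivative of `f(u + ε v)` at `ε = 0`. -/
def frechet (f v : DiffAlg) : DiffAlg := (perturb v f).snd

/-- `a` is the variational derivative `δF/δu`: `∫ tr (a v) = ∫ tr f_*[v]` for all `v`, where `f` is
any density of `F`. -/
def IsVarDeriv (F : Functional) (a : DiffAlg) : Prop :=
  ∀ f, intTr f = F → ∀ v, intTr (a * v) = intTr (frechet f v)

/-- Formal (pseudo-)difference operators: expressions built from left and right multiplications
and shifts by linear combinations, composition and formal inversion. -/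
inductive DiffOp : Type
  | lmul (f : DiffAlg) : DiffOp
  | rmul (f : DiffAlg) : DiffOp
  | shift (k : ℤ) : DiffOp
  | smul (c : ℝ) (K : DiffOp) : DiffOp
  | add (K L : DiffOp) : DiffOp
  | comp (K L : DiffOp) : DiffOp
  | inv (K : DiffOp) : DiffOp

namespace DiffOp

instance : Zero DiffOp := ⟨lmul 0⟩
instance : One DiffOp := ⟨shift 0⟩
instance : Add DiffOp := ⟨add⟩
instance : Mul DiffOp := ⟨comp⟩
instance : Neg DiffOp := ⟨smul (-1)⟩
instance : Sub DiffOp := ⟨fun K L => K + -L⟩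

/-- `K.Acts a b` says that `b` is a value of `K a`. A formal inverse acts as the inverse relation,
so `(S - 1)⁻¹` is defined on the image of `S - 1`, and its values are determined up to the kernel
of `S - 1`. -/
def Acts : DiffOp → DiffAlg → DiffAlg → Prop
  | lmul f, a, b => b = f * a
  | rmul f, a, b => b = a * f
  | shift k, a, b => b = NIB.shift k a
  | smul c K, a, b => ∃ b', K.Acts a b' ∧ b = c • b'
  | add K L, a, b => ∃ b₁ b₂, K.Acts a b₁ ∧ L.Acts a b₂ ∧ b = b₁ + b₂
  | comp K L, a, b => ∃ d, L.Acts a d ∧ K.Acts d b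
  | inv K, a, b => K.Acts b a

/-- The formal adjoint with respect to the pairing `∫ tr (a b)`. -/
def adjoint : DiffOp → DiffOp
  | lmul f => rmul f
  | rmul f => lmul f
  | shift k => shift (-k)
  | smul c K => smul c K.adjoint
  | add K L => add K.adjoint L.adjoint
  | comp K L => comp L.adjoint K.adjoint
  | inv K => inv K.adjoint

/-- `K† = -K` as (partially defined) operators. -/
def IsSkew (K : DiffOp) : Prop := ∀ a b, K.adjoint.Acts a b ↔ (-K).Acts a b

/-- `Q` is a value of `{F, G} = ∫ tr (δF/δu · K (δG/δu))`. -/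
def IsBracketValue (K : DiffOp) (F G Q : Functional) : Prop :=
  ∃ a b d, IsVarDeriv F a ∧ IsVarDeriv G b ∧ K.Acts b d ∧ Q = intTr (a * d)

/-- `K` is Hamiltonian: it is skewsymmetric and the formula `{F, G} = ∫ tr (δF/δu · K (δG/δu))`
defines, unambiguously and for all local functionals, a Lie algebra bracket. -/
def IsHamiltonian (K : DiffOp) : Prop :=
  K.IsSkew ∧ ∃ br : Functional →ₗ[ℝ] Functional →ₗ[ℝ] Functional,
    (∀ F G Q, K.IsBracketValue F G Q ↔ Q = br F G) ∧
    (∀ F, br F F = 0) ∧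
    (∀ A B C, br A (br B C) + br B (br C A) + br C (br A B) = 0)

/-- `X` is a value of `K (δF/δu)`, the characteristic of the evolutionary system `u_t = X` that `K`
produces for the functional `F`. -/
def Produces (K : DiffOp) (F : Functional) (X : DiffAlg) : Prop :=
  ∃ a, IsVarDeriv F a ∧ K.Acts a X

/-- The commutator operator `c_f = r_f - l_f`. -/
def cmul (f : DiffAlg) : DiffOp := rmul f - lmul f

/-- `r_u ∑_{i=1}^p S^i r_u - l_u ∑_{i=1}^p S^{-i} l_u + r_u c_u + c_u (S - 1)⁻¹ c_u`. -/
def nib (p : ℕ) : DiffOp :=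
  rmul (u 0) * ((List.range p).map fun i => shift ((i : ℤ) + 1)).sum * rmul (u 0)
    - lmul (u 0) * ((List.range p).map fun i => shift (-((i : ℤ) + 1))).sum * lmul (u 0)
    + rmul (u 0) * cmul (u 0)
    + cmul (u 0) * inv (shift 1 - 1) * cmul (u 0)

end DiffOp

end NIB

end

/-! The operator factors as `H = (r_u S^{p+1} - l_u)(S-1)⁻¹(r_u - S^{-p} l_u)`. Hence `H a =
S^{p+1}w · u - u w` (`flow`) for some `w` with `(S-1)w = a u - S^{-p}(u a)` (`IsPotential`), and the
nonlocality enters only through `w`.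

The bracket is defined everywhere because `[δF/δu, u]` lies in the image of `S-1`
(`exists_gradient`). It is single-valued because the kernel of `S-1` consists of constants
(`exists_const_of_shift_eq`), which `c_u` kills.

For Jacobi, the terms that differentiate variational derivatives cancel by self-adjointness of the
second variation (`IsVarDeriv.frechet_symm`). What remains comes from the coefficients of `H`. By
`IsPotential.shift_add`, `S^{p+1}` carries `w` to `S^{p+1}w`, and `S^p` carries `a u + w` to
`S^{p+1}w + u a`. The cubic form `∫ tr x[y,z]` is invariant under both shifts, and the difference of
the two invariance identities is the vanishing of the remainder (`trilinear_identity`). -/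

noncomputable section

namespace NIB

/-! ### Shift and trace -/

theorem shift_of (k : ℤ) (g : FreeGroup ℤ) :
    shift k (MonoidAlgebra.of ℝ _ g) =
      MonoidAlgebra.of ℝ _ (FreeGroup.map (fun n : ℤ => n + k) g) := by
  simp [shift]

@[simp]
theorem shift_u (k n : ℤ) : shift k (u n) = u (n + k) := by
  simp only [u, shift_of, FreeGroup.map.of]

@[simp]
theorem shift_uInv (k n : ℤ) : shift k (uInv n) = uInv (n + k) := by
  simp only [uInv, shift_of, map_inv, FreeGroup.map.of]

/-- Induction over sums and products of constants and letters. -/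
theorem DiffAlg.induction {P : DiffAlg → Prop} (hc : ∀ c : ℝ, P (c • 1))
    (hu : ∀ n, P (u n)) (hi : ∀ n, P (uInv n)) (hadd : ∀ f g, P f → P g → P (f + g))
    (hmul : ∀ f g, P f → P g → P (f * g)) (f : DiffAlg) : P f := by
  induction f using MonoidAlgebra.induction_on with
  | of g =>
    induction g using FreeGroup.induction_on with
    | C1 => simpa only [map_one, one_smul] using hc 1
    | of n => exact hu n
    | inv_of n _ => exact hi n
    | mul g h hg hh => rw [map_mul]; exact hmul _ _ hg hh
  | add f g hf hg => exact hadd f g hf hg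
  | smul r f hf => rw [← smul_one_mul]; exact hmul _ _ (hc r) hf

@[simp]
theorem shift_zero (f : DiffAlg) : shift 0 f = f := by
  induction f using DiffAlg.induction <;> simp_all

@[simp]
theorem shift_shift (j k : ℤ) (f : DiffAlg) : shift j (shift k f) = shift (k + j) f := by
  induction f using DiffAlg.induction <;> simp_all [add_assoc]

theorem intTr_mul_comm (f g : DiffAlg) : intTr (f * g) = intTr (g * f) :=
  (Submodule.Quotient.eq _).2
    (Submodule.mem_sup_right (Submodule.subset_span ⟨f, g, rfl⟩))

theorem intTr_shift_one (f : DiffAlg) : intTr (shift 1 f) = intTr f :=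
  (Submodule.Quotient.eq _).2 (Submodule.mem_sup_left (Submodule.subset_span ⟨f, rfl⟩))

theorem intTr_shift (k : ℤ) (f : DiffAlg) : intTr (shift k f) = intTr f := by
  induction k with
  | zero => simp
  | succ k ih => rw [← ih, ← intTr_shift_one (shift k f), shift_shift]
  | pred k ih => rw [← ih, ← intTr_shift_one (shift (-k - 1) f), shift_shift, sub_add_cancel]

/-- A linear map that kills shift differences and commutators kills `nullDensities`. -/
theorem eq_zero_of_mem_nullDensities {M : Type*} [AddCommGroup M] [Module ℝ M]
    (φ : DiffAlg →ₗ[ℝ] M) (hs : ∀ f, φ (shift 1 f) = φ f) (hc : ∀ f g, φ (f * g) = φ (g * f))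
    {x : DiffAlg} (hx : x ∈ nullDensities) : φ x = 0 := by
  have h : nullDensities ≤ LinearMap.ker φ := by
    refine sup_le (Submodule.span_le.2 ?_) (Submodule.span_le.2 ?_)
    · rintro _ ⟨f, rfl⟩
      simp [hs]
    · rintro _ ⟨f, g, rfl⟩
      simp [hc f g]
  exact h hx

/-- The coefficient of `1`. -/
def constCoeff : DiffAlg →ₗ[ℝ] ℝ :=
  Finsupp.lapply 1 ∘ₗ (MonoidAlgebra.coeffLinearEquiv ℝ).toLinearMap

theorem constCoeff_of (g : FreeGroup ℤ) [Decidable (g = 1)] :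
    constCoeff (MonoidAlgebra.of ℝ _ g) = if g = 1 then 1 else 0 := by
  classical
  simp [constCoeff, Finsupp.single_apply]

theorem constCoeff_shift (k : ℤ) (f : DiffAlg) : constCoeff (shift k f) = constCoeff f := by
  classical
  induction f using MonoidAlgebra.induction_on with
  | of g =>
    have h := FreeGroup.map_injective (add_left_injective k)
    rw [shift_of, constCoeff_of, constCoeff_of]
    simp only [map_eq_one_iff _ h]
  | add f g hf hg => simp [hf, hg]
  | smul r f hf => simp [hf]

theorem constCoeff_mul_comm (f g : DiffAlg) : constCoeff (f * g) = constCoeff (g * f) := by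
  classical
  induction f using MonoidAlgebra.induction_on with
  | of f =>
    induction g using MonoidAlgebra.induction_on with
    | of g => simp only [← map_mul, constCoeff_of, mul_eq_one_comm (a := f)]
    | add g h hg hh => simp only [mul_add, add_mul, map_add, hg, hh]
    | smul r g hg => simp only [mul_smul_comm, smul_mul_assoc, map_smul, hg]
  | add f h hf hh => simp only [mul_add, add_mul, map_add, hf, hh]
  | smul r f hf => simp only [mul_smul_comm, smul_mul_assoc, map_smul, hf]

/-- The pairing `∫ tr (a b)` is nondegenerate. -/
theorem eq_zero_of_intTr_mul {a : DiffAlg} (h : ∀ v, intTr (a * v) = 0) : a = 0 := by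
  have key : ∀ x : DiffAlg, intTr x = 0 → constCoeff x = 0 := fun x hx =>
    eq_zero_of_mem_nullDensities constCoeff (constCoeff_shift 1) constCoeff_mul_comm
      ((Submodule.Quotient.mk_eq_zero _).1 hx)
  ext g
  -- The coefficient of `1` is a shift-invariant trace; tested against `g⁻¹` it reads off the
  -- coefficient of `g`.
  have := key _ (h (MonoidAlgebra.of ℝ _ g⁻¹))
  simpa [constCoeff] using this

/-! ### The kernel of `S - 1` -/

/-- The substitution that replaces the letters outside `[-M, M]` by `1`. -/
def truncate (M : ℕ) : DiffAlg →ₐ[ℝ] DiffAlg :=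
  MonoidAlgebra.mapDomainAlgHom ℝ ℝ
    (FreeGroup.lift fun n : ℤ => if |n| ≤ M then FreeGroup.of n else 1)

theorem truncate_u (M : ℕ) (n : ℤ) : truncate M (u n) = if |n| ≤ M then u n else 1 := by
  split_ifs with h <;> simp [truncate, u, h, MonoidAlgebra.one_def]

theorem truncate_uInv (M : ℕ) (n : ℤ) : truncate M (uInv n) = if |n| ≤ M then uInv n else 1 := by
  split_ifs with h <;> simp [truncate, uInv, h, MonoidAlgebra.one_def]

/-- Only finitely many letters occur in `f`. Once they all lie in `[-M, M]`, a shift by `2M+1` moves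
every one of them out of that window. For a shift-invariant `f` the two truncations coincide, so `f`
is constant. -/
theorem exists_truncate (f : DiffAlg) : ∃ c : ℝ, ∃ N : ℕ, ∀ M : ℕ, N ≤ M →
    truncate M f = f ∧ truncate M (shift (2 * M + 1) f) = c • 1 := by
  induction f using DiffAlg.induction with
  | hc c => exact ⟨c, 0, fun M _ => by simp⟩
  | hu n =>
    refine ⟨1, n.natAbs, fun M hM => ⟨?_, ?_⟩⟩
    · rw [truncate_u, if_pos (by rw [abs_le]; omega)]
    · rw [shift_u, truncate_u, if_neg (by rw [abs_le]; omega), one_smul]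
  | hi n =>
    refine ⟨1, n.natAbs, fun M hM => ⟨?_, ?_⟩⟩
    · rw [truncate_uInv, if_pos (by rw [abs_le]; omega)]
    · rw [shift_uInv, truncate_uInv, if_neg (by rw [abs_le]; omega), one_smul]
  | hadd f g hf hg =>
    obtain ⟨c, N, h⟩ := hf
    obtain ⟨c', N', h'⟩ := hg
    refine ⟨c + c', max N N', fun M hM => ?_⟩
    have h1 := h M (by omega)
    have h2 := h' M (by omega)
    simp only [map_add, h1, h2, add_smul, and_self]
  | hmul f g hf hg =>
    obtain ⟨c, N, h⟩ := hf
    obtain ⟨c', N', h'⟩ := hg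
    refine ⟨c * c', max N N', fun M hM => ?_⟩
    have h1 := h M (by omega)
    have h2 := h' M (by omega)
    simp only [map_mul, h1, h2, smul_mul_smul_comm, mul_one, and_self]

theorem exists_const_of_shift_eq {f : DiffAlg} (h : shift 1 f = f) :
    ∃ c : ℝ, f = c • 1 := by
  have hk : ∀ k : ℕ, shift k f = f := by
    intro k
    induction k with
    | zero => simp
    | succ k ih =>
      have := shift_shift 1 k f
      rw [ih, h] at this
      rw [Nat.cast_succ, ← this]
  obtain ⟨c, N, hN⟩ := exists_truncate f
  obtain ⟨h1, h2⟩ := hN N le_rfl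
  refine ⟨c, ?_⟩
  have h3 := hk (2 * N + 1)
  push_cast at h3
  rw [← h2, h3, h1]

/-! ### Fréchet derivative -/

theorem perturb_of (v : DiffAlg) (g : FreeGroup ℤ) :
    perturb v (MonoidAlgebra.of ℝ _ g) =
      (FreeGroup.lift (perturbedGen v) g : DualNumber DiffAlg) := by
  simp [perturb]

theorem perturb_u (v : DiffAlg) (n : ℤ) :
    perturb v (u n) = TrivSqZeroExt.inl (u n) + TrivSqZeroExt.inr (shift n v) := by
  rw [u, perturb_of]; simp [perturbedGen, u]

theorem perturb_uInv (v : DiffAlg) (n : ℤ) : perturb v (uInv n) =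
    TrivSqZeroExt.inl (uInv n) - TrivSqZeroExt.inr (uInv n * shift n v * uInv n) := by
  rw [uInv, perturb_of, map_inv, FreeGroup.lift_apply_of]; rfl

theorem perturb_fst (v f : DiffAlg) : (perturb v f).fst = f := by
  induction f using DiffAlg.induction with
  | hc c => simp
  | hu n => simp [perturb_u]
  | hi n => simp [perturb_uInv]
  | hadd f g hf hg => simp [hf, hg]
  | hmul f g hf hg => simp [hf, hg]

@[simp]
theorem frechet_u (n : ℤ) (v : DiffAlg) : frechet (u n) v = shift n v := by
  simp [frechet, perturb_u]

@[simp]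
theorem frechet_uInv (n : ℤ) (v : DiffAlg) :
    frechet (uInv n) v = -(uInv n * shift n v * uInv n) := by
  simp [frechet, perturb_uInv]

@[simp]
theorem frechet_mul (f g v : DiffAlg) :
    frechet (f * g) v = f * frechet g v + frechet f v * g := by
  simp [frechet, perturb_fst]

/-- The Fréchet derivative as a linear map in the differentiated element. -/
def evo (v : DiffAlg) : DiffAlg →ₗ[ℝ] DiffAlg where
  toFun f := frechet f v
  map_add' f g := by simp only [frechet, map_add, TrivSqZeroExt.snd_add]
  map_smul' c f := by simp only [frechet, map_smul, TrivSqZeroExt.snd_smul, RingHom.id_apply]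

theorem evo_apply (v f : DiffAlg) : evo v f = frechet f v := rfl

theorem frechet_add (f g v : DiffAlg) : frechet (f + g) v = frechet f v + frechet g v :=
  map_add (evo v) f g

theorem frechet_smul (c : ℝ) (f v : DiffAlg) : frechet (c • f) v = c • frechet f v :=
  map_smul (evo v) c f

@[simp]
theorem frechet_one (v : DiffAlg) : frechet 1 v = 0 := by
  simp [frechet]

theorem frechet_sub (f g v : DiffAlg) : frechet (f - g) v = frechet f v - frechet g v :=
  map_sub (evo v) f g

theorem frechet_zero (v : DiffAlg) : frechet 0 v = 0 :=
  map_zero (evo v)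

theorem frechet_neg (f v : DiffAlg) : frechet (-f) v = -frechet f v :=
  map_neg (evo v) f

theorem frechet_shift (k : ℤ) (f v : DiffAlg) :
    frechet (shift k f) v = shift k (frechet f v) := by
  induction f using DiffAlg.induction with
  | hc c => simp [frechet_smul]
  | hu n => simp
  | hi n => simp
  | hadd f g hf hg => simp [frechet_add, hf, hg]
  | hmul f g hf hg => simp [hf, hg]

/-- Evolutionary derivations form a Lie algebra. -/
theorem frechet_frechet_sub (f v w : DiffAlg) :
    frechet (frechet f v) w - frechet (frechet f w) v =
      frechet f (frechet v w - frechet w v) := by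
  induction f using DiffAlg.induction with
  | hc c => simp [frechet_smul, frechet_zero]
  | hu n => simp [frechet_shift]
  | hi n =>
    simp only [frechet_uInv, frechet_neg, frechet_mul, frechet_shift, map_sub, mul_add,
      mul_sub, sub_mul, mul_neg, neg_mul, mul_assoc]
    abel
  | hadd f g hf hg =>
    simp only [frechet_add, ← hf, ← hg]; abel
  | hmul f g hf hg =>
    simp only [frechet_add, frechet_mul, ← hf, ← hg, mul_sub, sub_mul]; abel

/-- Evolutionary derivations commute with `S` and map commutators to sums of commutators, so they
descend to functionals and any density may be used. -/
theorem intTr_frechet_congr {f g : DiffAlg} (h : intTr f = intTr g) (v : DiffAlg) :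
    intTr (frechet f v) = intTr (frechet g v) := by
  have hx : f - g ∈ nullDensities := (Submodule.Quotient.eq _).1 h
  have := eq_zero_of_mem_nullDensities (intTr.comp (evo v))
    (fun f => by simp [evo_apply, frechet_shift, intTr_shift])
    (fun f g => by
      simp only [LinearMap.comp_apply, evo_apply, frechet_mul, map_add]
      rw [intTr_mul_comm f, intTr_mul_comm _ g, add_comm]) hx
  rw [map_sub, sub_eq_zero] at this
  exact this

/-! ### Variational derivatives -/

/-- The image of `S - 1`. -/
def shiftRange : Submodule ℝ DiffAlg :=
  LinearMap.range ((shift 1).toLinearMap - LinearMap.id)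

theorem mem_shiftRange {x : DiffAlg} : x ∈ shiftRange ↔ ∃ e, shift 1 e - e = x := by
  simp [shiftRange]

theorem shift_sub_mem_shiftRange (k : ℤ) (x : DiffAlg) : shift k x - x ∈ shiftRange := by
  have step : ∀ j : ℤ, shift (j + 1) x - shift j x ∈ shiftRange := fun j =>
    mem_shiftRange.2 ⟨shift j x, by rw [shift_shift]⟩
  induction k with
  | zero => simp
  | succ k ih => simpa using add_mem (step k) ih
  | pred k ih =>
    have := sub_mem ih (step (-k - 1))
    simpa using this

/-- The density `h f_*[v]` can be integrated by parts to `a v`, where `[a, u] = [h, f]` modulo the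
image of `S - 1`. -/
theorem exists_gradient (f : DiffAlg) : ∀ h : DiffAlg, ∃ a : DiffAlg,
    (∀ v, intTr (h * frechet f v) = intTr (a * v)) ∧
      (a * u 0 - u 0 * a) - (h * f - f * h) ∈ shiftRange := by
  induction f using DiffAlg.induction with
  | hc c =>
    refine fun h => ⟨0, fun v => ?_, ?_⟩
    · simp [frechet_smul]
    · simp
  | hu n =>
    refine fun h => ⟨shift (-n) h, fun v => ?_, ?_⟩
    · rw [frechet_u, ← intTr_shift n (shift (-n) h * v)]
      simp
    · have := shift_sub_mem_shiftRange (-n) (h * u n - u n * h)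
      simpa using this
  | hi n =>
    refine fun h => ⟨-shift (-n) (uInv n * h * uInv n), fun v => ?_, ?_⟩
    · rw [frechet_uInv, ← intTr_shift n (_ * v), mul_neg, neg_mul, map_neg, map_neg, map_neg,
        map_mul (shift n), shift_shift, neg_add_cancel, shift_zero, ← mul_assoc, intTr_mul_comm]
      simp only [mul_assoc]
    · have := shift_sub_mem_shiftRange (-n) (h * uInv n - uInv n * h)
      have h1 : u 0 = shift (-n) (u n) := by simp
      convert this using 1
      rw [h1, neg_mul, mul_neg, ← map_mul, ← map_mul, mul_assoc _ (uInv n) (u n), uInv_mul_u,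
        ← mul_assoc (u n), ← mul_assoc (u n), u_mul_uInv, map_sub]
      simp only [mul_one, one_mul]
      abel
  | hadd f g hf hg =>
    intro h
    obtain ⟨a, ha, ha'⟩ := hf h
    obtain ⟨b, hb, hb'⟩ := hg h
    refine ⟨a + b, fun v => ?_, ?_⟩
    · rw [frechet_add, mul_add, map_add, ha, hb, add_mul, map_add]
    · convert add_mem ha' hb' using 1
      simp only [mul_add, add_mul]
      abel
  | hmul f g hf hg =>
    intro h
    -- Cyclicity moves the other factor into the weight, which is why `h` is arbitrary; the
    -- commutators add up: `[gh, f] + [hf, g] = [h, fg]`.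
    obtain ⟨a, ha, ha'⟩ := hf (g * h)
    obtain ⟨b, hb, hb'⟩ := hg (h * f)
    refine ⟨a + b, fun v => ?_, ?_⟩
    · rw [frechet_mul, mul_add, map_add, ← mul_assoc h f, hb, ← mul_assoc h, intTr_mul_comm _ g,
        ← mul_assoc, ha, add_mul, map_add, add_comm]
    · convert add_mem ha' hb' using 1
      simp only [mul_add, add_mul, mul_assoc]
      abel

theorem exists_isVarDeriv (F : Functional) :
    ∃ a, IsVarDeriv F a ∧ a * u 0 - u 0 * a ∈ shiftRange := by
  obtain ⟨f, rfl⟩ := nullDensities.mkQ_surjective F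
  obtain ⟨a, ha, ha'⟩ := exists_gradient f 1
  refine ⟨a, fun g hg v => ?_, by simpa using ha'⟩
  rw [intTr_frechet_congr hg, ← ha, one_mul]

theorem IsVarDeriv.unique {F : Functional} {a b : DiffAlg} (ha : IsVarDeriv F a)
    (hb : IsVarDeriv F b) : a = b := by
  obtain ⟨f, hf⟩ := nullDensities.mkQ_surjective F
  refine sub_eq_zero.1 (eq_zero_of_intTr_mul fun v => ?_)
  rw [sub_mul, map_sub, ha f hf, hb f hf, sub_self]

/-- The variational derivative `δF/δu`. -/
def varDeriv : Functional →ₗ[ℝ] DiffAlg where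
  toFun F := (exists_isVarDeriv F).choose
  map_add' F G := by
    refine (exists_isVarDeriv (F + G)).choose_spec.1.unique fun h hh v => ?_
    obtain ⟨f, rfl⟩ := nullDensities.mkQ_surjective F
    obtain ⟨g, rfl⟩ := nullDensities.mkQ_surjective G
    have h1 : intTr h = intTr (f + g) := hh.trans (map_add intTr f g).symm
    rw [intTr_frechet_congr h1, frechet_add, add_mul, map_add, map_add]
    exact congrArg₂ (· + ·) ((exists_isVarDeriv _).choose_spec.1 f rfl v)
      ((exists_isVarDeriv _).choose_spec.1 g rfl v)
  map_smul' c F := by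
    refine (exists_isVarDeriv (c • F)).choose_spec.1.unique fun h hh v => ?_
    obtain ⟨f, rfl⟩ := nullDensities.mkQ_surjective F
    have h1 : intTr h = intTr (c • f) := hh.trans (map_smul intTr c f).symm
    rw [intTr_frechet_congr h1, frechet_smul, RingHom.id_apply, smul_mul_assoc, map_smul, map_smul]
    exact congrArg (c • ·) ((exists_isVarDeriv _).choose_spec.1 f rfl v)

theorem isVarDeriv_varDeriv (F : Functional) : IsVarDeriv F (varDeriv F) :=
  (exists_isVarDeriv F).choose_spec.1

theorem varDeriv_commutator_mem (F : Functional) :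
    varDeriv F * u 0 - u 0 * varDeriv F ∈ shiftRange :=
  (exists_isVarDeriv F).choose_spec.2

theorem isVarDeriv_iff {F : Functional} {a : DiffAlg} : IsVarDeriv F a ↔ a = varDeriv F :=
  ⟨fun h => h.unique (isVarDeriv_varDeriv F), fun h => h ▸ isVarDeriv_varDeriv F⟩

/-- The Fréchet derivative of a variational derivative is self-adjoint. -/
theorem IsVarDeriv.frechet_symm {F : Functional} {a : DiffAlg} (ha : IsVarDeriv F a)
    (v w : DiffAlg) : intTr (frechet a v * w) = intTr (frechet a w * v) := by
  obtain ⟨f, hf⟩ := nullDensities.mkQ_surjective F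
  have h : ∀ v w, intTr (frechet a v * w) =
      intTr (frechet (frechet f w) v) - intTr (a * frechet w v) := by
    intro v w
    rw [← intTr_frechet_congr (ha f hf w) v, frechet_mul, map_add, add_sub_cancel_left]
  -- The commutator of the two derivations is evolutionary, so it pairs with `a` and cancels the
  -- correction terms of `h`.
  have h2 := congrArg intTr (frechet_frechet_sub f w v)
  rw [map_sub, ← ha f hf, mul_sub, map_sub] at h2
  rw [h v w, h w v]
  linear_combination (norm := abel) h2

/-! ### The trilinear identity -/

/-- `w` is a potential of `a`: `(S - 1) w = a u - S^{-p} (u a)`. -/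
def IsPotential (p : ℕ) (a w : DiffAlg) : Prop :=
  shift 1 w - w = a * u 0 - shift (-p) (u 0 * a)

/-- The characteristic determined by a potential. -/
def flow (p : ℕ) (w : DiffAlg) : DiffAlg := shift (p + 1) w * u 0 - u 0 * w

/-- This is `S^p` of the defining relation, rearranged so that a single shift links the two sides.
-/
theorem IsPotential.shift_add {p : ℕ} {a w : DiffAlg} (h : IsPotential p a w) :
    shift p (a * u 0 + w) = shift (p + 1) w + u 0 * a := by
  have := congrArg (shift p) h
  simp only [map_sub, shift_shift, neg_add_cancel, shift_zero, add_comm (1 : ℤ)] at this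
  rw [map_add]
  linear_combination (norm := abel) -this

theorem intTr_mul_shift (k : ℤ) (x y : DiffAlg) :
    intTr (x * shift (-k) y) = intTr (shift k x * y) := by
  rw [← intTr_shift k (x * _), map_mul (shift k), shift_shift, neg_add_cancel, shift_zero]

/-- Integration by parts for the nonlocal operator. -/
theorem IsPotential.intTr_mul {p : ℕ} {a w : DiffAlg} (h : IsPotential p a w) {y c r q : DiffAlg}
    (hy : shift 1 y - y = c * u 0 + r - shift (-p) (q + u 0 * c)) :
    intTr (a * (shift (p + 1) y * u 0 - u 0 * y)) =
      -intTr (flow p w * c) + intTr ((a * u 0 + w) * r) -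
        intTr ((shift (p + 1) w + u 0 * a) * q) := by
  have e1 : intTr (shift p (a * u 0 + w) * shift (p + 1) y) =
      intTr ((a * u 0 + w) * shift 1 y) := by
    rw [← intTr_shift p (_ * shift 1 y), map_mul (shift p), shift_shift, add_comm (1 : ℤ)]
  have e2 : intTr (shift (p + 1) w * shift (p + 1) y) = intTr (w * y) := by
    rw [← map_mul (shift _), intTr_shift]
  have e3 := congrArg (fun x => intTr ((a * u 0 + w) * x)) hy
  have e4 := intTr_mul_shift p (a * u 0 + w) (q + u 0 * c)
  rw [h.shift_add] at e1 e4
  simp only [flow]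
  -- With shifted elements made opaque, the claim is linear algebra on cyclic words.
  generalize shift (-p) (q + u 0 * c) = z at e3 e4
  generalize shift (p + 1) y = y' at *
  generalize shift (p + 1) w = w' at *
  generalize shift 1 y = y'' at *
  simp only [mul_add, add_mul, mul_sub, sub_mul, map_add, map_sub, mul_assoc,
    intTr_mul_comm (u 0)] at e1 e2 e3 e4 ⊢
  linear_combination (norm := abel) e1 - e2 + e3 - e4

/-- Expanding `h₂` and removing its part free of `a`, `b`, `c`, which is `h₁`, leaves exactly the
cyclic sum of `R`. -/
theorem trilinear_identity {M : Type*} [AddCommGroup M] [Module ℝ M] (τ : DiffAlg →ₗ[ℝ] M)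
    (hτ : ∀ x y, τ (x * y) = τ (y * x)) {x a b c va vb vc wa wb wc : DiffAlg}
    (h₁ : τ (va * (vb * vc - vc * vb)) = τ (wa * (wb * wc - wc * wb)))
    (h₂ : τ ((va + x * a) * ((vb + x * b) * (vc + x * c) - (vc + x * c) * (vb + x * b))) =
      τ ((a * x + wa) * ((b * x + wb) * (c * x + wc) - (c * x + wc) * (b * x + wb))))
    {R : DiffAlg → DiffAlg → DiffAlg → DiffAlg → DiffAlg → DiffAlg → DiffAlg → DiffAlg → M}
    (hR : ∀ va wa b vb wb c vc wc, R va wa b vb wb c vc wc =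
      τ ((b * x + wb) * (c * (va * x - x * wa))) - τ ((vb + x * b) * ((va * x - x * wa) * c)) +
        τ (b * (vc * (va * x - x * wa) - (va * x - x * wa) * wc))) :
    R va wa b vb wb c vc wc + R vb wb c vc wc a va wa + R vc wc a va wa b vb wb = 0 := by
  simp only [hR]
  -- Each word contains exactly one of `a`, `va`, `wa`; it is rotated until that letter comes first.
  simp only [mul_add, add_mul, mul_sub, sub_mul, map_add, map_sub, mul_assoc, hτ x, hτ b, hτ c,
    hτ vb, hτ vc, hτ wb, hτ wc] at h₁ h₂ ⊢
  linear_combination (norm := abel) h₂ - h₁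

/-! ### The action of the operator -/

namespace DiffOp

theorem acts_add {K L : DiffOp} {a b : DiffAlg} :
    (K + L).Acts a b ↔ ∃ b₁ b₂, K.Acts a b₁ ∧ L.Acts a b₂ ∧ b = b₁ + b₂ := Iff.rfl

theorem acts_mul {K L : DiffOp} {a b : DiffAlg} :
    (K * L).Acts a b ↔ ∃ d, L.Acts a d ∧ K.Acts d b := Iff.rfl

theorem acts_neg {K : DiffOp} {a b : DiffAlg} : (-K).Acts a b ↔ ∃ b', K.Acts a b' ∧ b = -b' := by
  change (∃ b', K.Acts a b' ∧ b = (-1 : ℝ) • b') ↔ _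
  simp only [neg_one_smul]

theorem acts_sub {K L : DiffOp} {a b : DiffAlg} :
    (K - L).Acts a b ↔ ∃ b₁ b₂, K.Acts a b₁ ∧ L.Acts a b₂ ∧ b = b₁ - b₂ := by
  change (K + -L).Acts a b ↔ _
  simp only [acts_add, acts_neg]
  constructor
  · rintro ⟨b₁, _, h₁, ⟨b₂, h₂, rfl⟩, rfl⟩
    exact ⟨b₁, b₂, h₁, h₂, (sub_eq_add_neg _ _).symm⟩
  · rintro ⟨b₁, b₂, h₁, h₂, rfl⟩
    exact ⟨b₁, _, h₁, ⟨b₂, h₂, rfl⟩, sub_eq_add_neg _ _⟩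

theorem acts_lmul {f a b : DiffAlg} : (lmul f).Acts a b ↔ b = f * a := Iff.rfl

theorem acts_rmul {f a b : DiffAlg} : (rmul f).Acts a b ↔ b = a * f := Iff.rfl

theorem acts_shift {k : ℤ} {a b : DiffAlg} : (shift k).Acts a b ↔ b = NIB.shift k a := Iff.rfl

theorem acts_one {a b : DiffAlg} : (1 : DiffOp).Acts a b ↔ b = a := by
  change b = NIB.shift 0 a ↔ _
  rw [shift_zero]

theorem acts_inv {K : DiffOp} {a b : DiffAlg} : (inv K).Acts a b ↔ K.Acts b a := Iff.rfl

theorem acts_list_sum {l : List ℤ} {k : ℤ → ℤ} {a b : DiffAlg} :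
    (l.map fun i => shift (k i)).sum.Acts a b ↔ b = (l.map fun i => NIB.shift (k i) a).sum := by
  induction l generalizing b with
  | nil => exact acts_lmul.trans (by simp)
  | cons i l ih => simp [acts_add, ih, acts_shift]

theorem adjoint_list_sum_acts {l : List ℤ} {k : ℤ → ℤ} {a b : DiffAlg} :
    (l.map fun i => shift (k i)).sum.adjoint.Acts a b ↔
      b = (l.map fun i => NIB.shift (-k i) a).sum := by
  induction l generalizing b with
  -- The empty sum is `lmul 0`, whose adjoint is `rmul 0`.
  | nil => exact acts_rmul.trans (by simp)
  | cons i l ih =>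
    change (shift (-k i) + (l.map fun i => shift (k i)).sum.adjoint).Acts a b ↔ _
    simp [acts_add, ih, acts_shift]

theorem adjoint_add (K L : DiffOp) : (K + L).adjoint = K.adjoint + L.adjoint := rfl

theorem adjoint_sub (K L : DiffOp) : (K - L).adjoint = K.adjoint - L.adjoint := rfl

theorem adjoint_mul (K L : DiffOp) : (K * L).adjoint = L.adjoint * K.adjoint := rfl

/-- In `nib` the index list is coerced to integers through the list monad, which produces this form.
-/
theorem sum_map_cast_range (p : ℕ) (g : ℤ → DiffAlg) :
    (List.map g (List.range p >>= fun a => pure (a : ℤ))).sum = ∑ i ∈ Finset.range p, g i := by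
  simp only [bind_pure_comp, List.map_eq_map, List.map_map]
  rfl

theorem nib_acts {p : ℕ} {a b : DiffAlg} : (nib p).Acts a b ↔
    ∃ e, NIB.shift 1 e - e = a * u 0 - u 0 * a ∧
      b = (∑ i ∈ Finset.range p, NIB.shift (i + 1) (a * u 0)) * u 0 -
        u 0 * (∑ i ∈ Finset.range p, NIB.shift (-(i + 1)) (u 0 * a)) +
        (a * u 0 - u 0 * a) * u 0 + (e * u 0 - u 0 * e) := by
  simp only [nib, cmul, acts_add, acts_sub, acts_mul, acts_rmul, acts_lmul, acts_inv, acts_shift,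
    acts_one, acts_list_sum, sum_map_cast_range, exists_eq_left, exists_and_left]
  constructor
  · rintro ⟨_, ⟨e, he, rfl⟩, rfl⟩
    exact ⟨e, he.symm, rfl⟩
  · rintro ⟨e, he, rfl⟩
    exact ⟨_, ⟨e, he.symm, rfl⟩, rfl⟩

theorem nib_adjoint_acts {p : ℕ} {a b : DiffAlg} : (nib p).adjoint.Acts a b ↔
    ∃ e, NIB.shift (-1) e - e = u 0 * a - a * u 0 ∧
      b = u 0 * (∑ i ∈ Finset.range p, NIB.shift (-(i + 1)) (u 0 * a)) -
        (∑ i ∈ Finset.range p, NIB.shift (i + 1) (a * u 0)) * u 0 +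
        (u 0 * (u 0 * a) - u 0 * a * u 0) + (u 0 * e - e * u 0) := by
  have h1 : (1 : DiffOp).adjoint = 1 := congrArg shift neg_zero
  have h2 (f : DiffAlg) : (lmul f).adjoint = rmul f := rfl
  have h3 (f : DiffAlg) : (rmul f).adjoint = lmul f := rfl
  have h4 (k : ℤ) : (shift k).adjoint = shift (-k) := rfl
  have h5 (K : DiffOp) : (inv K).adjoint = inv K.adjoint := rfl
  simp only [nib, cmul, adjoint_add, adjoint_sub, adjoint_mul, h1, h2, h3, h4, h5, acts_add,
    acts_sub, acts_mul, acts_rmul, acts_lmul, acts_inv, acts_shift, acts_one,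
    adjoint_list_sum_acts, sum_map_cast_range, exists_eq_left, exists_and_left, neg_neg]
  constructor
  · rintro ⟨_, ⟨e, he, rfl⟩, rfl⟩
    exact ⟨e, he.symm, rfl⟩
  · rintro ⟨e, he, rfl⟩
    exact ⟨_, ⟨e, he.symm, rfl⟩, rfl⟩

/-- The adjoint of `(S-1)⁻¹` is `(S⁻¹-1)⁻¹ = -1 - (S-1)⁻¹`, the two preimages differing by one
shift. The extra `-c_u²` combines with `(r_u c_u)† = -c_u l_u` into `-r_u c_u`, since `c_u + l_u =
r_u`. -/
theorem nib_isSkew (p : ℕ) : (nib p).IsSkew := by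
  intro a b
  rw [nib_adjoint_acts, acts_neg]
  constructor
  · rintro ⟨e, he, rfl⟩
    have h := congrArg (NIB.shift 1) he
    have h' : NIB.shift (-1) e = e + (u 0 * a - a * u 0) := sub_eq_iff_eq_add'.1 he
    refine ⟨_, nib_acts.2 ⟨NIB.shift (-1) e, ?_, rfl⟩, ?_⟩
    · rw [shift_shift, neg_add_cancel, shift_zero, h']
      abel
    · rw [h']
      simp only [mul_add, add_mul, mul_sub, sub_mul, mul_assoc]
      abel
  · rintro ⟨_, h, rfl⟩
    obtain ⟨e, he, rfl⟩ := nib_acts.1 h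
    have h' : NIB.shift 1 e = e + (a * u 0 - u 0 * a) := sub_eq_iff_eq_add'.1 he
    refine ⟨NIB.shift 1 e, ?_, ?_⟩
    · rw [shift_shift, add_neg_cancel, shift_zero, h']
      abel
    · rw [h']
      simp only [mul_add, add_mul, mul_sub, sub_mul, mul_assoc]
      abel

/-! ### Factorization of the operator through potentials -/

theorem shift_potential (p : ℕ) {e b c : DiffAlg} (he : NIB.shift 1 e - e = b - c) :
    NIB.shift (p + 1) (e + ∑ i ∈ Finset.range p, NIB.shift (-(i + 1)) c) =
      NIB.shift 1 e + ∑ i ∈ Finset.range p, NIB.shift (i + 1) b := by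
  induction p with
  | zero => simp
  | succ p ih =>
    have he' : NIB.shift 1 e = e + (b - c) := sub_eq_iff_eq_add'.1 he
    have h : ∀ (k : ℕ) (x : DiffAlg),
        NIB.shift ((k + 1 : ℕ) + 1) x = NIB.shift 1 (NIB.shift (k + 1) x) := by
      intro k x
      rw [shift_shift]
      push_cast
      rfl
    rw [Finset.sum_range_succ, ← add_assoc, h, map_add (NIB.shift (p + 1)), ih, shift_shift,
      neg_add_cancel, shift_zero, Finset.sum_range_succ', map_add, map_add, map_sum]
    simp only [h, he', map_add, map_sub, Nat.cast_zero, zero_add]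
    abel

/-- The operator acts through potentials. -/
theorem exists_potential_of_nib_acts {p : ℕ} {a b : DiffAlg} (h : (nib p).Acts a b) :
    ∃ w, IsPotential p a w ∧ b = flow p w := by
  obtain ⟨e, he, rfl⟩ := nib_acts.1 h
  -- The sum telescopes under `S-1` to `u a - S^{-p}(u a)`, turning `a u - u a` into the required
  -- right-hand side.
  refine ⟨e + ∑ i ∈ Finset.range p, NIB.shift (-(i + 1)) (u 0 * a), ?_, ?_⟩
  · have h : ∀ q : ℕ, NIB.shift 1 (∑ i ∈ Finset.range q, NIB.shift (-(i + 1)) (u 0 * a)) -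
        ∑ i ∈ Finset.range q, NIB.shift (-(i + 1)) (u 0 * a) =
          u 0 * a - NIB.shift (-q) (u 0 * a) := by
      intro q
      rw [map_sum, ← Finset.sum_sub_distrib]
      simp only [shift_shift]
      have := Finset.sum_range_sub' (fun i : ℕ => NIB.shift (-(i : ℤ)) (u 0 * a)) q
      simp only [Nat.cast_zero, neg_zero, shift_zero, Nat.cast_succ] at this
      simpa using this
    unfold IsPotential
    rw [map_add]
    linear_combination (norm := abel) he + h p
  · rw [flow, shift_potential p he, sub_eq_iff_eq_add'.1 he]
    simp only [mul_add, add_mul, sub_mul, mul_assoc]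
    abel

/-! ### Domain, single-valuedness and linearity -/

theorem exists_nib_acts {a : DiffAlg} (p : ℕ) (h : a * u 0 - u 0 * a ∈ shiftRange) :
    ∃ b, (nib p).Acts a b := by
  obtain ⟨e, he⟩ := mem_shiftRange.1 h
  exact ⟨_, nib_acts.2 ⟨e, he, rfl⟩⟩

theorem nib_acts_unique {p : ℕ} {a b b' : DiffAlg} (h : (nib p).Acts a b)
    (h' : (nib p).Acts a b') : b = b' := by
  obtain ⟨e, he, rfl⟩ := nib_acts.1 h
  obtain ⟨e', he', rfl⟩ := nib_acts.1 h'
  obtain ⟨c, hc⟩ : ∃ c : ℝ, e - e' = c • 1 := exists_const_of_shift_eq (by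
    rw [map_sub]
    linear_combination (norm := abel) he - he')
  rw [sub_eq_iff_eq_add.1 hc]
  simp only [add_mul, mul_add, smul_mul_assoc, mul_smul_comm, one_mul, mul_one]
  abel

theorem nib_acts_add {p : ℕ} {a b a' b' : DiffAlg} (h : (nib p).Acts a b)
    (h' : (nib p).Acts a' b') : (nib p).Acts (a + a') (b + b') := by
  obtain ⟨e, he, rfl⟩ := nib_acts.1 h
  obtain ⟨e', he', rfl⟩ := nib_acts.1 h'
  refine nib_acts.2 ⟨e + e', ?_, ?_⟩
  · rw [map_add, add_mul, mul_add]
    linear_combination (norm := abel) he + he'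
  · simp only [add_mul, mul_add, map_add, sub_mul, Finset.sum_add_distrib]
    abel

theorem nib_acts_smul {p : ℕ} {a b : DiffAlg} (c : ℝ) (h : (nib p).Acts a b) :
    (nib p).Acts (c • a) (c • b) := by
  obtain ⟨e, he, rfl⟩ := nib_acts.1 h
  refine nib_acts.2 ⟨c • e, ?_, ?_⟩
  · rw [map_smul, smul_mul_assoc, mul_smul_comm, ← smul_sub, he, smul_sub]
  · simp only [smul_mul_assoc, mul_smul_comm, map_smul, ← Finset.smul_sum, ← smul_sub, ← smul_add]

/-! ### The bracket -/

/-- The Hamiltonian vector field of a functional. -/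
def hamField (p : ℕ) : Functional →ₗ[ℝ] DiffAlg where
  toFun F := (exists_nib_acts p (varDeriv_commutator_mem F)).choose
  map_add' F G := by
    refine nib_acts_unique (exists_nib_acts p (varDeriv_commutator_mem (F + G))).choose_spec ?_
    rw [map_add]
    exact nib_acts_add (exists_nib_acts p (varDeriv_commutator_mem F)).choose_spec
      (exists_nib_acts p (varDeriv_commutator_mem G)).choose_spec
  map_smul' c F := by
    refine nib_acts_unique (exists_nib_acts p (varDeriv_commutator_mem (c • F))).choose_spec ?_
    rw [map_smul]
    exact nib_acts_smul c (exists_nib_acts p (varDeriv_commutator_mem F)).choose_spec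

theorem nib_acts_hamField (p : ℕ) (F : Functional) :
    (nib p).Acts (varDeriv F) (hamField p F) :=
  (exists_nib_acts p (varDeriv_commutator_mem F)).choose_spec

theorem exists_potential (p : ℕ) (F : Functional) :
    ∃ w, IsPotential p (varDeriv F) w ∧ hamField p F = flow p w :=
  exists_potential_of_nib_acts (nib_acts_hamField p F)

theorem nib_acts_varDeriv {p : ℕ} {F : Functional} {b : DiffAlg} :
    (nib p).Acts (varDeriv F) b ↔ b = hamField p F :=
  ⟨fun h => nib_acts_unique h (nib_acts_hamField p F), fun h => h ▸ nib_acts_hamField p F⟩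

/-- The Poisson bracket of local functionals. -/
def bracket (p : ℕ) : Functional →ₗ[ℝ] Functional →ₗ[ℝ] Functional :=
  LinearMap.mk₂ ℝ (fun F G => intTr (varDeriv F * hamField p G))
    (fun F F' G => by rw [map_add, add_mul, map_add])
    (fun c F G => by rw [map_smul, smul_mul_assoc, map_smul])
    (fun F G G' => by rw [map_add, mul_add, map_add])
    (fun c F G => by rw [map_smul, mul_smul_comm, map_smul])

theorem bracket_apply (p : ℕ) (F G : Functional) :
    bracket p F G = intTr (varDeriv F * hamField p G) := rfl

theorem isBracketValue_nib {p : ℕ} {F G Q : Functional} :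
    (nib p).IsBracketValue F G Q ↔ Q = bracket p F G := by
  simp only [IsBracketValue, isVarDeriv_iff, bracket_apply]
  constructor
  · rintro ⟨_, _, d, rfl, rfl, hd, rfl⟩
    rw [nib_acts_varDeriv.1 hd]
  · rintro rfl
    exact ⟨_, _, _, rfl, rfl, nib_acts_hamField p G, rfl⟩

theorem bracket_antisymm (p : ℕ) (F G : Functional) : bracket p F G = -bracket p G F := by
  obtain ⟨w, hw, hX⟩ := exists_potential p F
  obtain ⟨y, hy, hY⟩ := exists_potential p G
  -- Skewsymmetry is the homogeneous case of the integration by parts.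
  have := hw.intTr_mul (y := y) (c := varDeriv G) (r := 0) (q := 0) (by
    rw [add_zero, zero_add]
    exact hy)
  rw [bracket_apply, bracket_apply, hX, hY, flow, this, mul_zero, mul_zero, map_zero, add_zero,
    sub_zero, intTr_mul_comm]

theorem bracket_self (p : ℕ) (F : Functional) : bracket p F F = 0 := by
  have h : (2 : ℝ) • bracket p F F = 0 := by
    rw [two_smul, ← eq_neg_iff_add_eq_zero]
    exact bracket_antisymm p F F
  exact (smul_eq_zero.1 h).resolve_left two_ne_zero

/-- The part of the Jacobiator that comes from the coefficients of the operator. -/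
def coeffTerm (va wa b vb wb c vc wc : DiffAlg) : Functional :=
  intTr ((b * u 0 + wb) * (c * (va * u 0 - u 0 * wa))) -
      intTr ((vb + u 0 * b) * ((va * u 0 - u 0 * wa) * c)) +
    intTr (b * (vc * (va * u 0 - u 0 * wa) - (va * u 0 - u 0 * wa) * wc))

/-- By antisymmetry the outer bracket is minus the derivative of the density of `{B, C}` along the
field of `A`, so `δ{B, C}/δu` is never computed. -/
theorem bracket_bracket {p : ℕ} {A B C : Functional} {wa wb wc : DiffAlg}
    (hA : hamField p A = flow p wa) (hB : hamField p B = flow p wb)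
    (hC : hamField p C = flow p wc) (hb : IsPotential p (varDeriv B) wb)
    (hc : IsPotential p (varDeriv C) wc) :
    bracket p A (bracket p B C) =
      intTr (frechet (varDeriv C) (hamField p A) * hamField p B) -
        intTr (frechet (varDeriv B) (hamField p A) * hamField p C) -
        coeffTerm (NIB.shift (p + 1) wa) wa (varDeriv B) (NIB.shift (p + 1) wb) wb
          (varDeriv C) (NIB.shift (p + 1) wc) wc := by
  set X := hamField p A with hX
  have h1 : bracket p A (bracket p B C) =
      -intTr (frechet (varDeriv B * hamField p C) X) := by
    rw [bracket_antisymm, bracket_apply,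
      isVarDeriv_varDeriv _ (varDeriv B * hamField p C) (bracket_apply p B C).symm]
  have h2 : frechet (hamField p C) X =
      (NIB.shift (p + 1) (frechet wc X) * u 0 - u 0 * frechet wc X) +
        (NIB.shift (p + 1) wc * X - X * wc) := by
    rw [hC, flow, frechet_sub, frechet_mul, frechet_mul, frechet_shift, frechet_u, shift_zero]
    abel
  -- Linearizing the potential equation also differentiates the explicit `u`; this yields the
  -- inhomogeneous terms `r` and `q`.
  have h3 : NIB.shift 1 (frechet wc X) - frechet wc X =
      frechet (varDeriv C) X * u 0 + varDeriv C * X -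
        NIB.shift (-p) (X * varDeriv C + u 0 * frechet (varDeriv C) X) := by
    have := congrArg (fun f => frechet f X) hc
    simp only [frechet_sub, frechet_shift, frechet_mul, frechet_u, shift_zero] at this
    rw [this, add_comm (varDeriv C * X), add_comm (X * varDeriv C)]
  have h4 := hb.intTr_mul h3
  rw [h1, frechet_mul, h2, map_add, mul_add, map_add, h4, ← hB, coeffTerm,
    intTr_mul_comm (hamField p B)]
  rw [← flow, ← hA]
  abel

theorem bracket_jacobi (p : ℕ) (A B C : Functional) :
    bracket p A (bracket p B C) + bracket p B (bracket p C A) +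
      bracket p C (bracket p A B) = 0 := by
  obtain ⟨wa, ha, hA⟩ := exists_potential p A
  obtain ⟨wb, hb, hB⟩ := exists_potential p B
  obtain ⟨wc, hc, hC⟩ := exists_potential p C
  have key := trilinear_identity intTr intTr_mul_comm (x := u 0)
    (a := varDeriv A) (b := varDeriv B) (c := varDeriv C)
    (va := NIB.shift (p + 1) wa) (vb := NIB.shift (p + 1) wb) (vc := NIB.shift (p + 1) wc)
    (wa := wa) (wb := wb) (wc := wc)
    (by simp only [← map_mul (NIB.shift _), ← map_sub (NIB.shift _), intTr_shift])
    (by simp only [← ha.shift_add, ← hb.shift_add, ← hc.shift_add, ← map_mul (NIB.shift _),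
          ← map_sub (NIB.shift _), intTr_shift])
    (R := coeffTerm) (fun _ _ _ _ _ _ _ _ => rfl)
  have sA := (isVarDeriv_varDeriv A).frechet_symm (hamField p B) (hamField p C)
  have sB := (isVarDeriv_varDeriv B).frechet_symm (hamField p C) (hamField p A)
  have sC := (isVarDeriv_varDeriv C).frechet_symm (hamField p A) (hamField p B)
  rw [bracket_bracket hA hB hC hb hc, bracket_bracket hB hC hA hc ha,
    bracket_bracket hC hA hB ha hb]
  linear_combination (norm := abel) sA + sB + sC - key

theorem nib_isHamiltonian (p : ℕ) : (nib p).IsHamiltonian :=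
  ⟨nib_isSkew p, bracket p, fun _ _ _ => isBracketValue_nib, bracket_self p, bracket_jacobi p⟩

/-! ### The lattice equation -/

theorem varDeriv_intTr_u : varDeriv (intTr (u 0)) = 1 :=
  (isVarDeriv_iff.1 fun f hf v => by
    rw [intTr_frechet_congr hf, frechet_u, shift_zero, one_mul]).symm

theorem produces_intTr_u {p : ℕ} {X : DiffAlg} : (nib p).Produces (intTr (u 0)) X ↔
    X = ∑ k ∈ Finset.Icc 1 p, (u k * u 0 - u 0 * u (-k)) := by
  have h : (nib p).Acts (varDeriv (intTr (u 0)))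
      (∑ k ∈ Finset.Icc 1 p, (u k * u 0 - u 0 * u (-k))) := by
    -- Since `[1, u] = 0`, the nonlocal term can take the preimage `0`.
    refine nib_acts.2 ⟨0, by simp [varDeriv_intTr_u], ?_⟩
    rw [varDeriv_intTr_u, Finset.range_eq_Ico, Finset.sum_mul, Finset.mul_sum,
      ← Finset.sum_sub_distrib, ← Finset.Ico_add_one_right_eq_Icc,
      Finset.sum_Ico_eq_sum_range, Finset.sum_Ico_eq_sum_range]
    simp [add_comm]
  simp only [Produces, isVarDeriv_iff, exists_eq_left]
  exact ⟨fun hX => nib_acts_unique hX h, fun hX => hX ▸ h⟩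

end DiffOp

end NIB

end

theorem mainTheorem1 (p : ℕ) (hp : 1 ≤ p) :
    (NIB.DiffOp.nib p).IsHamiltonian ∧
      ∀ X : NIB.DiffAlg, (NIB.DiffOp.nib p).Produces (NIB.intTr (NIB.u 0)) X ↔
        X = ∑ k ∈ Finset.Icc 1 p, (NIB.u k * NIB.u 0 - NIB.u 0 * NIB.u (-k)) :=
  ⟨NIB.DiffOp.nib_isHamiltonian p, fun _ => NIB.DiffOp.produces_intTr_u⟩
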